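/- Let $D=\{x\in\mathbb R^2:|x|<1\}$ and $S^1=\partial D$, identified with $\mathbb R/\mathbb Z$ through $t\mapsto(\cos 2\pi t,\sin 2\pi t)$. All triangles are nondegenerate and are regarded as closed regions. For a triangle $\triangle PQR\subset D$ and $v\in S^1$ there are exactly two points $u\in S^1\setminus\{v\}$ such that the segment $vu$ is tangent to $\triangle PQR$ (it touches the triangle, and the triangle lies on one side of the line $vu$); let $\psi_{\triangle PQR}(v)$ be the first of these two points met when moving counterclockwise from $v$. The map $\psi=\psi_{\triangle PQR}$ is a homeomorphism of $S^1$; its rotation number is $\rho(\psi)=\lim_{n\to\infty}\overline\psi^{\,n}(0)/n$, where $\overline\psi:\mathbb R\to\mathbb R$ is the lift of $\psi$ with $\overline\psi(0)\in(0,1)$. For a triangle in $\mathbb R^2$ let $\kappa(\triangle PQR)$ be its circumradius if it is acute, and half the length of its longest side if it is right or obtuse. Let $\mu(\triangle PQR)$ be the infimum of $\kappa(\triangle P'Q'R')$ over all triangles $\triangle P'Q'R'$ such that (1) $\triangle P'Q'R'\subset D$; (2) $\triangle P'Q'R'$ is similar to $\triangle PQR$; (3) $\rho(\psi_{\triangle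 P''Q''R''})=\frac13$ for every triangle $\triangle P''Q''R''\subset D$ congruent to $\triangle P'Q'R'$. Similarity and congruence are in the sense of Euclidean geometry. **Proposition 5.2.** For every triangle $\triangle PQR$ in $\mathbb R^2$, triangles satisfying (1)–(3) exist, and $0<\mu(\triangle PQR)<1$. -/

import Mathlib

namespace BarBilliard

/-- The Euclidean plane. -/
abbrev Plane : Type := EuclideanSpace ℝ (Fin 2)

/-- The open unit disk of the plane. -/
def disk : Set Plane := Metric.ball 0 1

/-- The point of the unit circle at parameter `v ∈ ℝ / ℤ`, that is `(cos 2πv, sin 2πv)`.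
Increasing the parameter moves counterclockwise. -/
noncomputable def circlePoint (v : UnitAddCircle) : Plane :=
  !₂[(AddCircle.toCircle v : ℂ).re, (AddCircle.toCircle v : ℂ).im]

/-- The closed region bounded by a (nondegenerate) triangle. -/
def region (T : Affine.Triangle ℝ Plane) : Set Plane := convexHull ℝ (Set.range T.points)

/-- The determinant of `q - p` and `x - p`: positive, zero or negative according to whether `x`
lies to the left of, on, or to the right of the line directed from `p` to `q`. -/
def side (p q x : Plane) : ℝ :=
  (q 0 - p 0) * (x 1 - p 1) - (q 1 - p 1) * (x 0 - p 0)

/-- The segment from `p` to `q` is tangent to the triangle `T`: it touches `T`, and `T` lies on one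
side of the line through `p` and `q`. -/
def IsTangent (T : Affine.Triangle ℝ Plane) (p q : Plane) : Prop :=
  (segment ℝ p q ∩ region T).Nonempty ∧
    ((∀ x ∈ region T, 0 ≤ side p q x) ∨ (∀ x ∈ region T, side p q x ≤ 0))

/-- The counterclockwise displacements `s ∈ (0, 1)` from `v` to the other endpoints of the chords
of the unit circle that start at `v` and are tangent to `T`. For a triangle in the open disk there
are exactly two. -/
def tangentDisplacements (T : Affine.Triangle ℝ Plane) (v : UnitAddCircle) : Set ℝ :=
  {s | s ∈ Set.Ioo (0 : ℝ) 1 ∧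
    IsTangent T (circlePoint v) (circlePoint (v + (s : UnitAddCircle)))}

/-- The bar billiard map `ψ_T` on the circle `ℝ / ℤ`: `v` is sent to the endpoint of the tangent
chord that is reached first when moving counterclockwise from `v`. -/
noncomputable def billiardMap (T : Affine.Triangle ℝ Plane) (v : UnitAddCircle) : UnitAddCircle :=
  v + ((sInf (tangentDisplacements T v) : ℝ) : UnitAddCircle)

/-- `F` is the continuous degree one lift of the circle map `ψ` with `F 0 ∈ (0, 1)`. -/
def IsNormalizedLift (ψ : UnitAddCircle → UnitAddCircle) (F : CircleDeg1Lift) : Prop :=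
  Continuous F ∧ (∀ x : ℝ, ((F x : ℝ) : UnitAddCircle) = ψ (x : UnitAddCircle)) ∧
    F 0 ∈ Set.Ioo (0 : ℝ) 1

/-- The circle map `ψ` has the rotation number `r`: the lift `F` of `ψ` with `F 0 ∈ (0, 1)` exists
and `F^n 0 / n` tends to `r` (Mathlib's translation number of `F`). -/
def HasRotationNumber (ψ : UnitAddCircle → UnitAddCircle) (r : ℝ) : Prop :=
  ∃ F : CircleDeg1Lift, IsNormalizedLift ψ F ∧ F.translationNumber = r

open Classical in
/-- The circumradius of an acute triangle; half of the longest side (the diameter of the set of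
vertices) of a right or obtuse triangle. -/
noncomputable def kappa (T : Affine.Triangle ℝ Plane) : ℝ :=
  if T.AcuteAngled then T.circumradius else Metric.diam (Set.range T.points) / 2

/-- The triangles `T'` in the disk that are similar to `T` and such that every triangle in the disk
congruent to `T'` gives a billiard map of rotation number `1 / 3`. -/
def admissible (T : Affine.Triangle ℝ Plane) : Set (Affine.Triangle ℝ Plane) :=
  {T' | region T' ⊆ disk ∧ Similar T'.points T.points ∧
    ∀ T'' : Affine.Triangle ℝ Plane, region T'' ⊆ disk → Congruent T''.points T'.points →
      HasRotationNumber (billiardMap T'') (1 / 3)}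

/-- The infimum of `kappa` over the admissible triangles similar to `T`. -/
noncomputable def mu (T : Affine.Triangle ℝ Plane) : ℝ := sInf (kappa '' admissible T)

end BarBilliard

namespace BarBilliard

open Real Set

/-! The lift `F` of the billiard map is the minimum over the three vertices of `chordMap`, the lift
of the involution exchanging the ends of each chord through the vertex. Its rotation number is
compared with `1 / 3` by comparing `F^3 x` with `x + 1` at one well-chosen `x`. Starting along an
edge shows that it is never below `1 / 3` (`one_third_le_translationNumber_billiardLift`). Since `F`
lies below each chord map, composing the three of them shows that it is at most `1 / 3` once two
vertices are close enough to the circle (`exists_chordMap_le`).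

For existence, write the centre of the smallest enclosing disk as a convex combination of the
vertices. By `sum_weighted_sq`, the mean of the squared norms of the vertices with these weights is
at least the squared radius, wherever a congruent copy is placed. If the radius is close to 1, every
vertex of positive weight, and there are at least two, is forced close to the circle
(`admissible_nonempty`).

The same identity gives `kappa < 1` in the disk, hence the upper bound for `mu`. Conversely, a
triangle with small `kappa` has a congruent copy near the centre, where each step advances by at
least `5 / 12` of a turn; this bounds `mu` away from zero. -/

/-! ### Chords of the unit circle through a point of the disk -/

/-- The point `(cos 2πx, sin 2πx)`. -/
noncomputable def unitPoint (x : ℝ) : Plane := circlePoint (x : UnitAddCircle)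

@[simp] lemma unitPoint_apply_zero (x : ℝ) : unitPoint x 0 = cos (2 * π * x) := by
  simp [unitPoint, circlePoint, AddCircle.toCircle_apply_mk, Circle.coe_exp, Complex.exp_re]

@[simp] lemma unitPoint_apply_one (x : ℝ) : unitPoint x 1 = sin (2 * π * x) := by
  simp [unitPoint, circlePoint, AddCircle.toCircle_apply_mk, Circle.coe_exp, Complex.exp_im]

lemma mem_disk_iff {V : Plane} : V ∈ disk ↔ V 0 ^ 2 + V 1 ^ 2 < 1 := by
  rw [disk, mem_ball_zero_iff, EuclideanSpace.norm_eq, Fin.sum_univ_two]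
  simp only [norm_eq_abs, sq_abs]
  rw [sqrt_lt' one_pos, one_pow]

/-- The inner product of `V` with the unit vector at parameter `m`. -/
noncomputable def height (V : Plane) (m : ℝ) : ℝ :=
  cos (2 * π * m) * V 0 + sin (2 * π * m) * V 1

/-- Half of the arc, in turns, cut off by the chord through `V` with normal direction `m`. -/
noncomputable def halfArc (V : Plane) (m : ℝ) : ℝ := arccos (height V m) / (2 * π)

lemma height_sq_add (V : Plane) (m : ℝ) :
    height V m ^ 2 + (-sin (2 * π * m) * V 0 + cos (2 * π * m) * V 1) ^ 2 =
      V 0 ^ 2 + V 1 ^ 2 := by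
  have := sin_sq_add_cos_sq (2 * π * m)
  rw [height]
  linear_combination (V 0 ^ 2 + V 1 ^ 2) * this

lemma height_sq_lt_one {V : Plane} (hV : V ∈ disk) (m : ℝ) : height V m ^ 2 < 1 := by
  have := height_sq_add V m
  nlinarith [mem_disk_iff.1 hV, sq_nonneg (-sin (2 * π * m) * V 0 + cos (2 * π * m) * V 1)]

lemma abs_height_lt_one {V : Plane} (hV : V ∈ disk) (m : ℝ) : |height V m| < 1 := by
  simpa using (sq_lt_sq.1 (by simpa using height_sq_lt_one hV m : height V m ^ 2 < 1 ^ 2))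

lemma hasDerivAt_height (V : Plane) (m : ℝ) :
    HasDerivAt (height V) (2 * π * (-sin (2 * π * m) * V 0 + cos (2 * π * m) * V 1)) m := by
  have h : HasDerivAt (fun m : ℝ => 2 * π * m) (2 * π) m := by
    simpa using (hasDerivAt_id m).const_mul (2 * π)
  have := (h.cos.mul_const (V 0)).add (h.sin.mul_const (V 1))
  refine this.congr_deriv ?_
  ring

/-- With `h` the height and `D` the component of `V` along the chord, the derivative is `-D / √(1 -
h²)`, while `h² + D² = |V|² < 1`. Hence both ends `m ± halfArc V m` move strictly counterclockwise
as the normal turns. -/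
lemma exists_hasDerivAt_halfArc {V : Plane} (hV : V ∈ disk) (m : ℝ) :
    ∃ d : ℝ, |d| < 1 ∧ HasDerivAt (halfArc V) d m := by
  have hlt := abs_lt.1 (abs_height_lt_one hV m)
  have hd := ((hasDerivAt_arccos (ne_of_gt hlt.1) (ne_of_lt hlt.2)).comp m
    (hasDerivAt_height V m)).div_const (2 * π)
  refine ⟨_, ?_, hd⟩
  have hpos : 0 < 1 - height V m ^ 2 := by linarith [height_sq_lt_one hV m]
  have hs : 0 < √(1 - height V m ^ 2) := sqrt_pos.2 hpos
  set D := -sin (2 * π * m) * V 0 + cos (2 * π * m) * V 1 with hD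
  have : -(1 / √(1 - height V m ^ 2)) * (2 * π * D) / (2 * π) = -(D / √(1 - height V m ^ 2)) := by
    field_simp
  rw [this, abs_neg, abs_div, abs_of_pos hs, div_lt_one hs]
  apply lt_sqrt_of_sq_lt
  rw [sq_abs]
  linarith [height_sq_add V m, mem_disk_iff.1 hV]

lemma strictMono_sub_halfArc {V : Plane} (hV : V ∈ disk) :
    StrictMono fun m => m - halfArc V m := by
  refine strictMono_of_deriv_pos fun m => ?_
  obtain ⟨d, hd, h⟩ := exists_hasDerivAt_halfArc hV m
  rw [((hasDerivAt_id' m).fun_sub h).deriv]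
  linarith [(abs_lt.1 hd).2]

lemma strictMono_add_halfArc {V : Plane} (hV : V ∈ disk) :
    StrictMono fun m => m + halfArc V m := by
  refine strictMono_of_deriv_pos fun m => ?_
  obtain ⟨d, hd, h⟩ := exists_hasDerivAt_halfArc hV m
  rw [((hasDerivAt_id' m).fun_add h).deriv]
  linarith [(abs_lt.1 hd).1]

lemma continuous_halfArc (V : Plane) : Continuous (halfArc V) := by
  unfold halfArc height
  fun_prop

lemma halfArc_pos {V : Plane} (hV : V ∈ disk) (m : ℝ) : 0 < halfArc V m :=
  div_pos (arccos_pos.2 (abs_lt.1 (abs_height_lt_one hV m)).2) two_pi_pos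

/-- Reversing the normal keeps the chord and selects the complementary arc; this makes `chordMap` an
involution up to a full turn. -/
lemma halfArc_add_half (V : Plane) (m : ℝ) : halfArc V (m + 1 / 2) = 1 / 2 - halfArc V m := by
  have : height V (m + 1 / 2) = -height V m := by
    rw [height, height, show 2 * π * (m + 1 / 2) = 2 * π * m + π by ring, cos_add_pi, sin_add_pi]
    ring
  rw [halfArc, this, arccos_neg, halfArc]
  field_simp

lemma halfArc_add_one (V : Plane) (m : ℝ) : halfArc V (m + 1) = halfArc V m := by
  rw [show m + 1 = m + 1 / 2 + 1 / 2 by ring, halfArc_add_half, halfArc_add_half]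
  ring

lemma halfArc_lt_half {V : Plane} (hV : V ∈ disk) (m : ℝ) : halfArc V m < 1 / 2 := by
  linarith [halfArc_add_half V m, halfArc_pos hV (m + 1 / 2)]

lemma exists_sub_halfArc_eq {V : Plane} (hV : V ∈ disk) (x : ℝ) :
    ∃ m, m - halfArc V m = x := by
  have hc : Continuous fun m => m - halfArc V m := continuous_id.sub (continuous_halfArc V)
  have h1 : x - halfArc V x ≤ x := by linarith [halfArc_pos hV x]
  have h2 : x ≤ (x + 1) - halfArc V (x + 1) := by linarith [halfArc_lt_half hV (x + 1)]
  obtain ⟨m, -, hm⟩ := intermediate_value_Icc (by linarith : x ≤ x + 1) hc.continuousOn ⟨h1, h2⟩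
  exact ⟨m, hm⟩

/-- The lift of the involution of the circle that sends a point to the other endpoint of the chord
through `V`. -/
noncomputable def chordMap (V : Plane) (x : ℝ) : ℝ :=
  -- The near end `x` determines the normal `m`, and the two ends average to `m`.
  2 * Function.invFun (fun m => m - halfArc V m) x - x

lemma chordMap_sub_halfArc {V : Plane} (hV : V ∈ disk) (m : ℝ) :
    chordMap V (m - halfArc V m) = m + halfArc V m := by
  have := Function.leftInverse_invFun (strictMono_sub_halfArc hV).injective m
  rw [chordMap, this]
  ring

lemma strictMono_chordMap {V : Plane} (hV : V ∈ disk) : StrictMono (chordMap V) := by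
  intro x y hxy
  obtain ⟨m, rfl⟩ := exists_sub_halfArc_eq hV x
  obtain ⟨n, rfl⟩ := exists_sub_halfArc_eq hV y
  rw [chordMap_sub_halfArc hV, chordMap_sub_halfArc hV]
  exact strictMono_add_halfArc hV ((strictMono_sub_halfArc hV).lt_iff_lt.1 hxy)

lemma chordMap_add_one {V : Plane} (hV : V ∈ disk) (x : ℝ) :
    chordMap V (x + 1) = chordMap V x + 1 := by
  obtain ⟨m, rfl⟩ := exists_sub_halfArc_eq hV x
  have := chordMap_sub_halfArc hV (m + 1)
  rw [halfArc_add_one] at this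
  rw [chordMap_sub_halfArc hV, show m - halfArc V m + 1 = m + 1 - halfArc V m by ring, this]
  ring

lemma chordMap_chordMap {V : Plane} (hV : V ∈ disk) (x : ℝ) :
    chordMap V (chordMap V x) = x + 1 := by
  obtain ⟨m, rfl⟩ := exists_sub_halfArc_eq hV x
  have := chordMap_sub_halfArc hV (m + 1 / 2)
  rw [halfArc_add_half] at this
  rw [chordMap_sub_halfArc hV, show m + halfArc V m = m + 1 / 2 - (1 / 2 - halfArc V m) by ring,
    this]
  ring

lemma continuous_chordMap {V : Plane} (hV : V ∈ disk) : Continuous (chordMap V) := by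
  refine (strictMono_chordMap hV).monotone.continuous_of_surjective fun y =>
    ⟨chordMap V (y - 1), ?_⟩
  rw [chordMap_chordMap hV, sub_add_cancel]

lemma lt_chordMap {V : Plane} (hV : V ∈ disk) (x : ℝ) : x < chordMap V x := by
  obtain ⟨m, rfl⟩ := exists_sub_halfArc_eq hV x
  rw [chordMap_sub_halfArc hV]
  linarith [halfArc_pos hV m]

lemma chordMap_lt_add_one {V : Plane} (hV : V ∈ disk) (x : ℝ) : chordMap V x < x + 1 := by
  rw [← chordMap_chordMap hV x]
  exact lt_chordMap hV _

lemma side_unitPoint (V : Plane) (x s : ℝ) :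
    side (unitPoint x) (unitPoint (x + s)) V =
      2 * sin (π * s) * (cos (π * s) - height V (x + s / 2)) := by
  set u := 2 * π * (x + s / 2) with hu
  have h1 : 2 * π * x = u - π * s := by rw [hu]; ring
  have h2 : 2 * π * (x + s) = u + π * s := by rw [hu]; ring
  have hs := sin_sq_add_cos_sq u
  simp only [side, unitPoint_apply_zero, unitPoint_apply_one, height, h1, h2, ← hu, sin_add,
    sin_sub, cos_add, cos_sub]
  linear_combination (2 * sin (π * s) * cos (π * s)) * hs

/-- The far end is `2 * m - x`, so the left side says `m ≤ x + s / 2`; monotonicity of `m - halfArc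
V m` turns this into a bound on `halfArc V (x + s / 2)`. -/
lemma chordMap_le_iff_height {V : Plane} (hV : V ∈ disk) (x : ℝ) {s : ℝ} (hs : s ∈ Ioo (0 : ℝ) 1) :
    chordMap V x ≤ x + s ↔ cos (π * s) ≤ height V (x + s / 2) := by
  have hm := abs_lt.1 (abs_height_lt_one hV (x + s / 2))
  obtain ⟨m, hmx⟩ := exists_sub_halfArc_eq hV x
  have h1 : m ≤ x + s / 2 ↔ m - halfArc V m ≤ x + s / 2 - halfArc V (x + s / 2) :=
    (strictMono_sub_halfArc hV).le_iff_le.symm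
  have h2 : chordMap V x = 2 * m - x := by
    rw [← hmx, chordMap_sub_halfArc hV]; ring
  have h3 : cos (π * s) ≤ height V (x + s / 2) ↔ arccos (height V (x + s / 2)) ≤ π * s := by
    conv_lhs => rw [← cos_arccos hm.1.le hm.2.le]
    exact strictAntiOn_cos.le_iff_ge
      ⟨by nlinarith [pi_pos, hs.1], by nlinarith [pi_pos, hs.2]⟩
      ⟨arccos_nonneg _, arccos_le_pi _⟩
  have h4 : arccos (height V (x + s / 2)) = 2 * π * halfArc V (x + s / 2) := by
    rw [halfArc]; field_simp
  rw [h3, h4, h2, show 2 * π * halfArc V (x + s / 2) ≤ π * s ↔ halfArc V (x + s / 2) ≤ s / 2 by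
    constructor <;> intro h <;> nlinarith [pi_pos]]
  constructor
  · intro h
    have := h1.1 (by linarith)
    linarith
  · intro h
    have := h1.2 (by linarith)
    linarith

lemma le_chordMap_iff_height {V : Plane} (hV : V ∈ disk) (x : ℝ) {s : ℝ} (hs : s ∈ Ioo (0 : ℝ) 1) :
    x + s ≤ chordMap V x ↔ height V (x + s / 2) ≤ cos (π * s) := by
  have hm := abs_lt.1 (abs_height_lt_one hV (x + s / 2))
  obtain ⟨m, hmx⟩ := exists_sub_halfArc_eq hV x
  have h1 : x + s / 2 ≤ m ↔ x + s / 2 - halfArc V (x + s / 2) ≤ m - halfArc V m :=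
    (strictMono_sub_halfArc hV).le_iff_le.symm
  have h2 : chordMap V x = 2 * m - x := by
    rw [← hmx, chordMap_sub_halfArc hV]; ring
  have h3 : height V (x + s / 2) ≤ cos (π * s) ↔ π * s ≤ arccos (height V (x + s / 2)) := by
    conv_lhs => rw [← cos_arccos hm.1.le hm.2.le]
    exact strictAntiOn_cos.le_iff_ge
      ⟨arccos_nonneg _, arccos_le_pi _⟩
      ⟨by nlinarith [pi_pos, hs.1], by nlinarith [pi_pos, hs.2]⟩
  have h4 : arccos (height V (x + s / 2)) = 2 * π * halfArc V (x + s / 2) := by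
    rw [halfArc]; field_simp
  rw [h3, h4, h2, show π * s ≤ 2 * π * halfArc V (x + s / 2) ↔ s / 2 ≤ halfArc V (x + s / 2) by
    constructor <;> intro h <;> nlinarith [pi_pos]]
  constructor
  · intro h
    have := h1.1 (by linarith)
    linarith
  · intro h
    have := h1.2 (by linarith)
    linarith

lemma sin_pi_mul_pos {s : ℝ} (hs : s ∈ Ioo (0 : ℝ) 1) : 0 < sin (π * s) :=
  sin_pos_of_pos_of_lt_pi (by nlinarith [pi_pos, hs.1]) (by nlinarith [pi_pos, hs.2])

lemma chordMap_le_iff {V : Plane} (hV : V ∈ disk) (x : ℝ) {s : ℝ} (hs : s ∈ Ioo (0 : ℝ) 1) :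
    chordMap V x ≤ x + s ↔ side (unitPoint x) (unitPoint (x + s)) V ≤ 0 := by
  rw [chordMap_le_iff_height hV x hs, side_unitPoint, ← neg_nonneg, ← mul_neg,
    mul_nonneg_iff_of_pos_left (mul_pos two_pos (sin_pi_mul_pos hs))]
  constructor <;> intro h <;> linarith

lemma le_chordMap_iff {V : Plane} (hV : V ∈ disk) (x : ℝ) {s : ℝ} (hs : s ∈ Ioo (0 : ℝ) 1) :
    x + s ≤ chordMap V x ↔ 0 ≤ side (unitPoint x) (unitPoint (x + s)) V := by
  rw [le_chordMap_iff_height hV x hs, side_unitPoint,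
    mul_nonneg_iff_of_pos_left (mul_pos two_pos (sin_pi_mul_pos hs)), sub_nonneg]

/-! ### The lift of the billiard map -/

lemma side_combo (p q x y : Plane) {a b : ℝ} (hab : a + b = 1) :
    side p q (a • x + b • y) = a * side p q x + b * side p q y := by
  obtain rfl : b = 1 - a := by linarith
  simp only [side, PiLp.add_apply, PiLp.smul_apply, smul_eq_mul]
  ring

lemma convex_preimage_side (p q : Plane) {s : Set ℝ} (hs : Convex ℝ s) :
    Convex ℝ (side p q ⁻¹' s) := by
  intro x hx y hy a b ha hb hab
  rw [mem_preimage, side_combo p q x y hab]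
  exact hs hx hy ha hb hab

lemma side_mem_of_mem_region {T : Affine.Triangle ℝ Plane} {p q : Plane} {s : Set ℝ}
    (hs : Convex ℝ s) (h : ∀ i, side p q (T.points i) ∈ s) {x : Plane} (hx : x ∈ region T) :
    side p q x ∈ s :=
  convexHull_min (t := side p q ⁻¹' s) (range_subset_iff.2 h) (convex_preimage_side p q hs) hx

lemma points_mem_region (T : Affine.Triangle ℝ Plane) (i : Fin 3) : T.points i ∈ region T :=
  subset_convexHull ℝ _ (mem_range_self i)

lemma region_subset_disk_iff {T : Affine.Triangle ℝ Plane} :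
    region T ⊆ disk ↔ ∀ i, T.points i ∈ disk :=
  ⟨fun h i => h (points_mem_region T i),
    fun h => convexHull_min (range_subset_iff.2 h) (convex_ball 0 1)⟩

lemma side_eq_zero_of_mem_segment {p q x : Plane} (hx : x ∈ segment ℝ p q) : side p q x = 0 := by
  obtain ⟨a, b, -, -, hab, rfl⟩ := hx
  rw [side_combo p q p q hab]
  simp only [side]
  ring

lemma mem_segment_of_side_eq_zero {x s : ℝ} (hs : s ∈ Ioo (0 : ℝ) 1) {V : Plane} (hV : V ∈ disk)
    (h : side (unitPoint x) (unitPoint (x + s)) V = 0) :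
    V ∈ segment ℝ (unitPoint x) (unitPoint (x + s)) := by
  have hpq : unitPoint x ≠ unitPoint (x + s) := by
    intro he
    have h2 := sin_pi_mul_pos hs
    have h5 := congrArg (fun v : Plane => v 0 * unitPoint x 0 + v 1 * unitPoint x 1) he
    simp only [unitPoint_apply_zero, unitPoint_apply_one, ← sq, cos_sq_add_sin_sq, ← cos_sub] at h5
    rw [show 2 * π * (x + s) - 2 * π * x = 2 * (π * s) by ring, cos_two_mul] at h5
    nlinarith [sin_sq_add_cos_sq (π * s)]
  have hp : unitPoint x 0 ^ 2 + unitPoint x 1 ^ 2 = 1 := by simp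
  have hq : unitPoint (x + s) 0 ^ 2 + unitPoint (x + s) 1 ^ 2 = 1 := by simp
  generalize unitPoint x = p at *
  generalize unitPoint (x + s) = q at *
  have hN : 0 < (q 0 - p 0) ^ 2 + (q 1 - p 1) ^ 2 := by
    by_contra hN
    apply hpq
    have h0 : q 0 - p 0 = 0 := by nlinarith [sq_nonneg (q 0 - p 0), sq_nonneg (q 1 - p 1)]
    have h1 : q 1 - p 1 = 0 := by nlinarith [sq_nonneg (q 0 - p 0), sq_nonneg (q 1 - p 1)]
    ext i
    fin_cases i
    · simp only [Fin.zero_eta]; linarith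
    · simp only [Fin.mk_one]; linarith
  set N := (q 0 - p 0) ^ 2 + (q 1 - p 1) ^ 2 with hNdef
  set t := ((V 0 - p 0) * (q 0 - p 0) + (V 1 - p 1) * (q 1 - p 1)) / N with ht
  rw [side] at h
  have htN : t * N = (V 0 - p 0) * (q 0 - p 0) + (V 1 - p 1) * (q 1 - p 1) := by
    rw [ht]; field_simp
  have e0 : V 0 = (1 - t) * p 0 + t * q 0 := by
    apply mul_right_cancel₀ hN.ne'
    linear_combination (-(q 0 - p 0)) * htN - (q 1 - p 1) * h + (V 0 - p 0) * hNdef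
  have e1 : V 1 = (1 - t) * p 1 + t * q 1 := by
    apply mul_right_cancel₀ hN.ne'
    linear_combination (-(q 1 - p 1)) * htN + (q 0 - p 0) * h + (V 1 - p 1) * hNdef
  have hlt := mem_disk_iff.1 hV
  -- The power of the point `V`: being inside the circle forces `t * (1 - t) > 0`.
  have key : V 0 ^ 2 + V 1 ^ 2 = 1 - t * (1 - t) * N := by
    rw [e0, e1, hNdef]
    linear_combination (1 - t) * hp + t * hq
  have hpos : 0 < t * (1 - t) := pos_of_mul_pos_left (by linarith : 0 < t * (1 - t) * N) hN.le
  have ht0 : 0 < t := by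
    by_contra hc
    nlinarith
  have ht1 : 0 < 1 - t := pos_of_mul_pos_right hpos ht0.le
  refine ⟨1 - t, t, ht1.le, ht0.le, by ring, ?_⟩
  ext i
  fin_cases i
  · simp [e0]
  · simp [e1]

/-- The smallest of the values at `x` of the chord maps of the vertices. -/
noncomputable def billiardLiftFun (T : Affine.Triangle ℝ Plane) (x : ℝ) : ℝ :=
  Finset.univ.inf' ⟨(0 : Fin 3), Finset.mem_univ _⟩ fun i => chordMap (T.points i) x

variable {T : Affine.Triangle ℝ Plane}

lemma billiardLiftFun_le (T : Affine.Triangle ℝ Plane) (i : Fin 3) (x : ℝ) :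
    billiardLiftFun T x ≤ chordMap (T.points i) x :=
  Finset.inf'_le (fun i => chordMap (T.points i) x) (Finset.mem_univ i)

lemma exists_billiardLiftFun_eq (T : Affine.Triangle ℝ Plane) (x : ℝ) :
    ∃ i, billiardLiftFun T x = chordMap (T.points i) x := by
  obtain ⟨i, -, hi⟩ := Finset.exists_mem_eq_inf' ⟨(0 : Fin 3), Finset.mem_univ _⟩
    fun i => chordMap (T.points i) x
  exact ⟨i, hi⟩

lemma le_billiardLiftFun_iff {x y : ℝ} :
    y ≤ billiardLiftFun T x ↔ ∀ i, y ≤ chordMap (T.points i) x := by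
  exact (Finset.le_inf'_iff _ _).trans (by simp)

/-- The continuous lift of the billiard map of a triangle in the disk. -/
noncomputable def billiardLift (hT : region T ⊆ disk) : CircleDeg1Lift where
  toFun := billiardLiftFun T
  monotone' x y hxy := le_billiardLiftFun_iff.2 fun i => (billiardLiftFun_le T i x).trans
    ((strictMono_chordMap (region_subset_disk_iff.1 hT i)).monotone hxy)
  map_add_one' x := by
    have h := region_subset_disk_iff.1 hT
    apply le_antisymm
    · obtain ⟨i, hi⟩ := exists_billiardLiftFun_eq T x
      rw [hi, ← chordMap_add_one (h i)]
      exact billiardLiftFun_le T i _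
    · rw [le_billiardLiftFun_iff]
      intro i
      rw [chordMap_add_one (h i)]
      exact add_le_add_left (billiardLiftFun_le T i x) 1

variable (hT : region T ⊆ disk)

lemma billiardLift_le (i : Fin 3) (x : ℝ) : billiardLift hT x ≤ chordMap (T.points i) x :=
  billiardLiftFun_le T i x

lemma exists_billiardLift_eq (x : ℝ) : ∃ i, billiardLift hT x = chordMap (T.points i) x :=
  exists_billiardLiftFun_eq T x

lemma le_billiardLift_iff {x y : ℝ} :
    y ≤ billiardLift hT x ↔ ∀ i, y ≤ chordMap (T.points i) x :=
  le_billiardLiftFun_iff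

lemma continuous_billiardLift : Continuous (billiardLift hT) :=
  Continuous.finset_inf'_apply ⟨(0 : Fin 3), Finset.mem_univ _⟩ fun i _ => continuous_chordMap (region_subset_disk_iff.1 hT i)

lemma billiardLift_sub_mem (x : ℝ) : billiardLift hT x - x ∈ Ioo (0 : ℝ) 1 := by
  obtain ⟨i, hi⟩ := exists_billiardLift_eq hT x
  have hV := region_subset_disk_iff.1 hT i
  rw [hi]
  constructor <;> linarith [lt_chordMap hV x, chordMap_lt_add_one hV x]

/-- At the minimum all vertices are weakly to the left of the chord and one is on it. For a smaller
displacement all are strictly to the left, so by convexity the chord misses the triangle. -/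
lemma isLeast_tangentDisplacements (x : ℝ) :
    IsLeast (tangentDisplacements T (x : UnitAddCircle)) (billiardLift hT x - x) := by
  have h := region_subset_disk_iff.1 hT
  have hs₀ := billiardLift_sub_mem hT x
  have hu : ∀ s : ℝ, circlePoint ((x : UnitAddCircle) + (s : UnitAddCircle)) = unitPoint (x + s) :=
    fun s => by rw [unitPoint, AddCircle.coe_add]
  constructor
  · have hnonneg : ∀ i, 0 ≤ side (unitPoint x) (unitPoint (x + (billiardLift hT x - x)))
        (T.points i) := fun i => by
      rw [← le_chordMap_iff (h i) x hs₀, add_sub_cancel]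
      exact billiardLift_le hT i x
    refine ⟨hs₀, ?_⟩
    rw [hu]
    refine ⟨?_, Or.inl fun z hz => side_mem_of_mem_region (convex_Ici 0) hnonneg hz⟩
    obtain ⟨i, hi⟩ := exists_billiardLift_eq hT x
    refine ⟨T.points i, mem_segment_of_side_eq_zero hs₀ (h i) (le_antisymm ?_ (hnonneg i)),
      points_mem_region T i⟩
    rw [← chordMap_le_iff (h i) x hs₀, add_sub_cancel]
    exact hi.ge
  · rintro s ⟨hs, ht⟩
    rw [hu] at ht
    obtain ⟨⟨z, hz, hzT⟩, hside⟩ := ht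
    have : ∃ i, side (unitPoint x) (unitPoint (x + s)) (T.points i) ≤ 0 := by
      by_contra! hpos
      have := side_mem_of_mem_region (convex_Ioi 0) hpos hzT
      exact (this : (0 : ℝ) < _).ne' (side_eq_zero_of_mem_segment hz)
    obtain ⟨i, hi⟩ := this
    rw [← chordMap_le_iff (h i) x hs] at hi
    linarith [billiardLift_le hT i x]

lemma isNormalizedLift_billiardLift : IsNormalizedLift (billiardMap T) (billiardLift hT) := by
  refine ⟨continuous_billiardLift hT, fun x => ?_, by simpa using billiardLift_sub_mem hT 0⟩
  rw [billiardMap, (isLeast_tangentDisplacements hT x).csInf_eq, ← AddCircle.coe_add,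
    add_sub_cancel]

/-- The difference of two lifts is continuous and integer-valued, so its absolute value cannot cross
`1 / 2`; the normalization makes it vanish at `0`. -/
lemma IsNormalizedLift.unique {ψ : UnitAddCircle → UnitAddCircle} {F G : CircleDeg1Lift}
    (hF : IsNormalizedLift ψ F) (hG : IsNormalizedLift ψ G) : F = G := by
  have hint : ∀ x, ∃ n : ℤ, F x - G x = n := fun x => by
    have h : ((F x - G x : ℝ) : UnitAddCircle) = 0 := by
      rw [AddCircle.coe_sub, hF.2.1, hG.2.1, sub_self]
    obtain ⟨n, hn⟩ := (AddCircle.coe_eq_zero_iff (1 : ℝ)).1 h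
    exact ⟨n, by simpa using hn.symm⟩
  have hc : Continuous fun x => F x - G x := hF.1.sub hG.1
  have hmiss : ∀ x, |F x - G x| ≠ 1 / 2 := fun x hx => by
    obtain ⟨n, hn⟩ := hint x
    rw [hn, ← Int.cast_abs] at hx
    have : ((2 * |n| : ℤ) : ℝ) = (1 : ℤ) := by push_cast at hx ⊢; linarith
    have := Int.cast_injective this
    omega
  have hzero : |F 0 - G 0| < 1 / 2 := by
    obtain ⟨n, hn⟩ := hint 0
    have h1 := hF.2.2
    have h2 := hG.2.2
    have h3 : (n : ℝ) < (1 : ℤ) := by rw [← hn]; push_cast; linarith [h1.2, h2.1]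
    have h4 : ((-1 : ℤ) : ℝ) < n := by rw [← hn]; push_cast; linarith [h1.1, h2.2]
    rw [hn, show n = 0 by have := Int.cast_lt.1 h3; have := Int.cast_lt.1 h4; omega]
    simp
  have hlt : ∀ x, |F x - G x| < 1 / 2 := fun x => by
    by_contra! hx
    obtain ⟨y, hy⟩ := mem_range_of_exists_le_of_exists_ge hc.abs ⟨0, hzero.le⟩ ⟨x, hx⟩
    exact hmiss y hy
  ext x
  obtain ⟨n, hn⟩ := hint x
  have h := hlt x
  rw [hn, ← Int.cast_abs] at h
  have h1 : ((|n| : ℤ) : ℝ) < (1 : ℤ) := by push_cast at h ⊢; linarith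
  have h0 : n = 0 := Int.abs_lt_one_iff.1 (Int.cast_lt.1 h1)
  rw [h0, Int.cast_zero] at hn
  linarith

lemma hasRotationNumber_billiardMap_iff {r : ℝ} :
    HasRotationNumber (billiardMap T) r ↔ (billiardLift hT).translationNumber = r := by
  refine ⟨?_, fun h => ⟨_, isNormalizedLift_billiardLift hT, h⟩⟩
  rintro ⟨F, hF, rfl⟩
  rw [hF.unique (isNormalizedLift_billiardLift hT)]

/-! ### Bounds for the rotation number -/

lemma exists_polar (a b : ℝ) : ∃ φ : ℝ, a = √(a ^ 2 + b ^ 2) * cos (2 * π * φ) ∧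
    b = √(a ^ 2 + b ^ 2) * sin (2 * π * φ) := by
  set z : ℂ := ⟨a, b⟩ with hz
  have hn : ‖z‖ = √(a ^ 2 + b ^ 2) := by
    rw [Complex.norm_def, Complex.normSq_apply, ← sq, ← sq]
  have hφ : 2 * π * (z.arg / (2 * π)) = z.arg := by field_simp
  refine ⟨z.arg / (2 * π), ?_, ?_⟩
  · rw [hφ, ← hn, Complex.norm_mul_cos_arg]
  · rw [hφ, ← hn, Complex.norm_mul_sin_arg]

lemma chordMap_eq_of_height_eq {V W : Plane} (hV : V ∈ disk) (hW : W ∈ disk) {m : ℝ}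
    (h : height W m = height V m) :
    chordMap W (m - halfArc V m) = chordMap V (m - halfArc V m) := by
  have : halfArc V m = halfArc W m := by rw [halfArc, halfArc, h]
  rw [chordMap_sub_halfArc hV, this, chordMap_sub_halfArc hW]

lemma chordMap_le_of_height_le {V W : Plane} (hV : V ∈ disk) (hW : W ∈ disk) {m : ℝ}
    (h : height W m ≤ height V m) :
    chordMap V (m - halfArc V m) ≤ chordMap W (m - halfArc V m) := by
  have harc : halfArc V m ≤ halfArc W m :=
    div_le_div_of_nonneg_right (antitone_arccos h) two_pi_pos.le
  obtain ⟨n, hn⟩ := exists_sub_halfArc_eq hW (m - halfArc V m)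
  have hmn : m ≤ n := (strictMono_sub_halfArc hW).le_iff_le.1 (by linarith)
  have h1 := chordMap_sub_halfArc hW n
  rw [hn] at h1
  rw [h1, chordMap_sub_halfArc hV]
  linarith

/-- Some direction is the outer normal of the edge `PQ` of the triangle `PQR`. -/
lemma exists_height_eq {P Q : Plane} (hPQ : P ≠ Q) (R : Plane) :
    ∃ m, height Q m = height P m ∧ height R m ≤ height P m := by
  -- The sign `ε` orients the edge so that `R` is on its left; the outer normal is then the edge
  -- vector turned clockwise.
  have key : ∀ ε : ℝ, ε ^ 2 = 1 → 0 ≤ ε * side P Q R →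
      ∃ m, height Q m = height P m ∧ height R m ≤ height P m := by
    intro ε hε hside
    obtain ⟨φ, h0, h1⟩ := exists_polar (ε * (Q 1 - P 1)) (-(ε * (Q 0 - P 0)))
    set r := √((ε * (Q 1 - P 1)) ^ 2 + (-(ε * (Q 0 - P 0))) ^ 2) with hr
    have hrpos : 0 < r := by
      rw [hr, sqrt_pos]
      by_contra hN
      apply hPQ
      have e : (ε * (Q 1 - P 1)) ^ 2 + (-(ε * (Q 0 - P 0))) ^ 2 =
          (Q 1 - P 1) ^ 2 + (Q 0 - P 0) ^ 2 := by
        linear_combination ((Q 1 - P 1) ^ 2 + (Q 0 - P 0) ^ 2) * hε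
      rw [e] at hN
      have h0 : Q 0 - P 0 = 0 := by nlinarith [sq_nonneg (Q 0 - P 0), sq_nonneg (Q 1 - P 1)]
      have h1 : Q 1 - P 1 = 0 := by nlinarith [sq_nonneg (Q 0 - P 0), sq_nonneg (Q 1 - P 1)]
      ext i
      fin_cases i
      · simp only [Fin.zero_eta]; linarith
      · simp only [Fin.mk_one]; linarith
    have hh : ∀ V : Plane, r * height V φ = ε * ((Q 1 - P 1) * V 0 - (Q 0 - P 0) * V 1) := by
      intro V
      rw [height]
      linear_combination (-V 0) * h0 - V 1 * h1
    refine ⟨φ, mul_left_cancel₀ hrpos.ne' ?_, le_of_mul_le_mul_left ?_ hrpos⟩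
    · rw [hh, hh]; ring
    · rw [hh, hh]
      rw [side] at hside
      linarith
  rcases le_total 0 (side P Q R) with h | h
  · exact key 1 (by norm_num) (by linarith)
  · exact key (-1) (by norm_num) (by linarith)

lemma pow_three_apply (F : CircleDeg1Lift) (x : ℝ) : (F ^ 3) x = F (F (F x)) := by
  simp [pow_succ]

lemma one_third_le_translationNumber {F : CircleDeg1Lift} {x : ℝ} (h : x + 1 ≤ F (F (F x))) :
    1 / 3 ≤ F.translationNumber := by
  have := (F ^ 3).le_translationNumber_of_add_nat_le (x := x) (m := 1)
    (by rw [pow_three_apply]; exact_mod_cast h)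
  rw [CircleDeg1Lift.translationNumber_pow] at this
  push_cast at this
  linarith

lemma translationNumber_le_one_third {F : CircleDeg1Lift} {x : ℝ} (h : F (F (F x)) ≤ x + 1) :
    F.translationNumber ≤ 1 / 3 := by
  have := (F ^ 3).translationNumber_le_of_le_add_nat (x := x) (m := 1)
    (by rw [pow_three_apply]; exact_mod_cast h)
  rw [CircleDeg1Lift.translationNumber_pow] at this
  push_cast at this
  linarith

lemma points_injective (T : Affine.Triangle ℝ Plane) : Function.Injective T.points :=
  T.independent.injective

/-- The rotation number is at least `1 / 3` for every triangle in the disk. -/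
lemma one_third_le_translationNumber_billiardLift (hT : region T ⊆ disk) :
    1 / 3 ≤ (billiardLift hT).translationNumber := by
  have hd := region_subset_disk_iff.1 hT
  set F := billiardLift hT with hF
  have hlt : ∀ x, x ≤ F x := fun x => by linarith [(billiardLift_sub_mem hT x).1]
  -- From `x` the chord runs along the edge of vertices 0 and 1, so `F` agrees there with both of
  -- their chord maps.
  obtain ⟨m, hm1, hm2⟩ := exists_height_eq
    ((points_injective T).ne (by decide : (0 : Fin 3) ≠ 1)) (T.points 2)
  set x := m - halfArc (T.points 0) m with hx
  have e1 : chordMap (T.points 1) x = chordMap (T.points 0) x :=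
    chordMap_eq_of_height_eq (hd 0) (hd 1) hm1
  have e2 : chordMap (T.points 0) x ≤ chordMap (T.points 2) x :=
    chordMap_le_of_height_le (hd 0) (hd 2) hm2
  have e0 : F x = chordMap (T.points 0) x := by
    apply le_antisymm (billiardLift_le hT 0 x)
    rw [le_billiardLift_iff]
    intro i
    fin_cases i
    · exact le_rfl
    · exact e1.ge
    · exact e2
  have ex : ∀ i : Fin 3, i ≠ 2 → F x = chordMap (T.points i) x := by
    intro i hi
    fin_cases i
    · exact e0
    · exact e0.trans e1.symm
    · exact absurd rfl hi
  apply one_third_le_translationNumber (x := x)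
  -- If `j ≠ 2` the first chord is retraced, and if `j = k = 2` the second one is. Otherwise,
  -- falling short of `x + 1` and applying the chord map of `k` again would give `F (F x) < F x`.
  obtain ⟨j, hj⟩ := exists_billiardLift_eq hT (F x)
  obtain ⟨k, hk⟩ := exists_billiardLift_eq hT (F (F x))
  rw [← hF] at hj hk
  by_cases hj2 : j = 2
  · subst hj2
    by_cases hk2 : k = 2
    · subst hk2
      rw [hk, hj, chordMap_chordMap (hd 2)]
      linarith [hlt x]
    · by_contra! hw
      have h1 := strictMono_chordMap (hd k) hw
      rw [hk, chordMap_chordMap (hd k), chordMap_add_one (hd k), ← ex k hk2] at h1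
      linarith [hlt (F x)]
  · rw [ex j hj2, chordMap_chordMap (hd j), ← ex j hj2] at hj
    rw [← hj]
    exact hlt _

/-! ### Triangles with two vertices near the circle, and triangles near the centre -/

lemma dist_sq_eq (p q : Plane) : dist p q ^ 2 = (p 0 - q 0) ^ 2 + (p 1 - q 1) ^ 2 := by
  rw [EuclideanSpace.dist_eq, sq_sqrt (by positivity), Fin.sum_univ_two, Real.dist_eq, Real.dist_eq,
    sq_abs, sq_abs]

lemma abs_det_le_dist_mul_dist (p p' q q' : Plane) :
    |(p 0 - p' 0) * (q 1 - q' 1) - (p 1 - p' 1) * (q 0 - q' 0)| ≤ dist p p' * dist q q' := by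
  apply abs_le_of_sq_le_sq _ (by positivity)
  rw [mul_pow, dist_sq_eq, dist_sq_eq]
  nlinarith [sq_nonneg ((p 0 - p' 0) * (q 0 - q' 0) + (p 1 - p' 1) * (q 1 - q' 1))]

lemma side_le_side_add (p p' q x : Plane) :
    side p q x ≤ side p' q x + dist p p' * dist q x := by
  have h := (le_abs_self _).trans (abs_det_le_dist_mul_dist p p' q x)
  rw [side, side]
  linarith

lemma side_rotate (p q x : Plane) : side p q x = side q x p := by
  rw [side, side]; ring

/-- The power of the point `B`: if `B` is near the circle and one end of the chord is not near `B`,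
then the other end is. -/
lemma dist_mul_dist_of_mem_segment {P U B : Plane} (hP : P 0 ^ 2 + P 1 ^ 2 = 1)
    (hU : U 0 ^ 2 + U 1 ^ 2 = 1) (hB : B ∈ segment ℝ P U) :
    dist U B * dist B P = 1 - (B 0 ^ 2 + B 1 ^ 2) := by
  obtain ⟨s, t, hs, ht, hst, rfl⟩ := hB
  obtain rfl : s = 1 - t := by linarith
  have h1 : dist U ((1 - t) • P + t • U) = (1 - t) * dist U P := by
    rw [dist_eq_norm, dist_eq_norm, show U - ((1 - t) • P + t • U) = (1 - t) • (U - P) by module,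
      norm_smul, norm_eq_abs, abs_of_nonneg hs]
  have h2 : dist ((1 - t) • P + t • U) P = t * dist U P := by
    rw [dist_eq_norm, dist_eq_norm, show (1 - t) • P + t • U - P = t • (U - P) by module,
      norm_smul, norm_eq_abs, abs_of_nonneg ht]
  have h3 := dist_sq_eq U P
  rw [h1, h2]
  simp only [PiLp.add_apply, PiLp.smul_apply, smul_eq_mul]
  linear_combination (1 - t) * t * h3 + (1 - t) * hP + t * hU

lemma unitPoint_sq_add_sq (x : ℝ) : unitPoint x 0 ^ 2 + unitPoint x 1 ^ 2 = 1 := by simp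

lemma dist_lt_two {p q : Plane} (hp : p 0 ^ 2 + p 1 ^ 2 < 1) (hq : q 0 ^ 2 + q 1 ^ 2 ≤ 1) :
    dist p q < 2 := by
  apply lt_of_pow_lt_pow_left₀ 2 (by norm_num)
  rw [dist_sq_eq]
  nlinarith [sq_nonneg (p 0 + q 0), sq_nonneg (p 1 + q 1)]

/-- The chord of the unit circle with midpoint `A`. -/
lemma exists_chord_midpoint {A : Plane} (hA : A ∈ disk) (hA0 : 0 < A 0 ^ 2 + A 1 ^ 2) :
    ∃ a s K : ℝ, s ∈ Ioo (0 : ℝ) 1 ∧ 0 < K ∧ chordMap A a = a + s ∧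
      (∀ V : Plane, side (unitPoint a) (unitPoint (a + s)) V =
        K * (A 0 * V 0 + A 1 * V 1 - (A 0 ^ 2 + A 1 ^ 2))) ∧
      dist (unitPoint a) A ^ 2 = 1 - (A 0 ^ 2 + A 1 ^ 2) ∧
      dist (unitPoint (a + s)) A ^ 2 = 1 - (A 0 ^ 2 + A 1 ^ 2) := by
  have hA1 := mem_disk_iff.1 hA
  obtain ⟨φ, hφ0, hφ1⟩ := exists_polar (A 0) (A 1)
  have hr2 : √(A 0 ^ 2 + A 1 ^ 2) ^ 2 = A 0 ^ 2 + A 1 ^ 2 := sq_sqrt hA0.le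
  have hr0 : 0 < √(A 0 ^ 2 + A 1 ^ 2) := sqrt_pos.2 hA0
  generalize √(A 0 ^ 2 + A 1 ^ 2) = r at *
  have hr1 : r < 1 := by nlinarith
  -- The ends are at `w` turns on either side of the direction `φ` of `A`; the chord starts at `φ +
  -- w` and spans the long arc, of length `1 - 2 * w`.
  obtain ⟨w, hw⟩ : ∃ w, arccos r = 2 * π * w := ⟨arccos r / (2 * π), by field_simp⟩
  have hcosw : cos (2 * π * w) = r := by rw [← hw, cos_arccos (by linarith) hr1.le]
  have hw0 : 0 < w := by
    have := arccos_pos.2 hr1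
    rw [hw] at this
    exact pos_of_mul_pos_right this two_pi_pos.le
  have hw1 : w < 1 / 4 := by
    have := arccos_lt_pi_div_two.2 hr0
    nlinarith [pi_pos]
  have hs : 1 - 2 * w ∈ Ioo (0 : ℝ) 1 := ⟨by linarith, by linarith⟩
  have hsin := sin_pi_mul_pos hs
  have hside : ∀ V : Plane, side (unitPoint (φ + w)) (unitPoint (φ + w + (1 - 2 * w))) V =
      2 * sin (π * (1 - 2 * w)) / r * (A 0 * V 0 + A 1 * V 1 - (A 0 ^ 2 + A 1 ^ 2)) := by
    intro V
    have hh : r * (-cos (2 * π * w) - height V (φ + w + (1 - 2 * w) / 2)) =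
        A 0 * V 0 + A 1 * V 1 - (A 0 ^ 2 + A 1 ^ 2) := by
      rw [height, show 2 * π * (φ + w + (1 - 2 * w) / 2) = 2 * π * φ + π by ring,
        cos_add_pi, sin_add_pi, hcosw, ← hr2]
      linear_combination (-V 0) * hφ0 - V 1 * hφ1
    rw [side_unitPoint, ← hh, show π * (1 - 2 * w) = π - 2 * π * w by ring, cos_pi_sub]
    field_simp
  have hdist : ∀ y : ℝ, cos (2 * π * (y - φ)) = r →
      dist (unitPoint y) A ^ 2 = 1 - (A 0 ^ 2 + A 1 ^ 2) := by
    intro y hy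
    rw [dist_sq_eq]
    have hyy := unitPoint_sq_add_sq y
    rw [mul_sub, cos_sub, ← unitPoint_apply_zero, ← unitPoint_apply_one] at hy
    linear_combination hyy - 2 * r * hy - 2 * unitPoint y 0 * hφ0 - 2 * unitPoint y 1 * hφ1 -
      2 * hr2
  refine ⟨φ + w, 1 - 2 * w, _, hs, div_pos (mul_pos two_pos hsin) hr0, ?_, hside,
    hdist _ ?_, hdist _ ?_⟩
  · have h0 := hside A
    rw [← sq, ← sq, sub_self, mul_zero] at h0
    exact le_antisymm ((chordMap_le_iff hA _ hs).2 h0.le) ((le_chordMap_iff hA _ hs).2 h0.ge)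
  · rw [add_sub_cancel_left, hcosw]
  · rw [show 2 * π * (φ + w + (1 - 2 * w) - φ) = 2 * π - 2 * π * w by ring, cos_two_pi_sub, hcosw]

lemma mem_segment_chordMap {V : Plane} (hV : V ∈ disk) (x : ℝ) :
    V ∈ segment ℝ (unitPoint x) (unitPoint (chordMap V x)) := by
  have hs : chordMap V x - x ∈ Ioo (0 : ℝ) 1 :=
    ⟨by linarith [lt_chordMap hV x], by linarith [chordMap_lt_add_one hV x]⟩
  have h1 := chordMap_le_iff hV x hs
  have h2 := le_chordMap_iff hV x hs
  have h3 := mem_segment_of_side_eq_zero (x := x) hs hV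
  rw [add_sub_cancel] at h1 h2 h3
  exact h3 (le_antisymm (h1.1 le_rfl) (h2.1 le_rfl))

/-- If two vertices of a triangle in the disk are close to the circle, then following the chords
through its three vertices leads around the circle at most once. -/
lemma exists_chordMap_le {A B C : Plane} {δ : ℝ} (hA : A ∈ disk) (hB : B ∈ disk) (hC : C ∈ disk)
    (hδ : 0 < δ) (hside : 4 * δ ≤ side A B C) (hA' : 1 - δ ^ 2 ≤ A 0 ^ 2 + A 1 ^ 2)
    (hB' : 1 - δ ^ 2 ≤ B 0 ^ 2 + B 1 ^ 2) :
    ∃ a, chordMap A (chordMap C (chordMap B a)) ≤ a + 1 := by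
  have hA1 := mem_disk_iff.1 hA
  have hB1 := mem_disk_iff.1 hB
  have hC1 := mem_disk_iff.1 hC
  have hAB : 2 * δ ≤ dist A B := by
    have h1 : side A B C ≤ dist B A * dist C A :=
      (le_abs_self _).trans (abs_det_le_dist_mul_dist B A C A)
    rw [dist_comm B A] at h1
    have h2 := dist_lt_two hC1 hA1.le
    nlinarith [dist_nonneg (x := A) (y := B)]
  have hδ1 : δ < 1 := by linarith [dist_lt_two hA1 hB1.le]
  -- Both ends of the chord bisected by `A` are within `δ` of `A`, and `A` sends `a + s` to `a + 1`.
  -- It remains to see that `B` and then `C` lead from `a` no further than `a + s`.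
  obtain ⟨a, s, K, hs, hK, hAa, hsideK, hda, hdc⟩ := exists_chord_midpoint hA (by nlinarith)
  replace hda : dist (unitPoint a) A ≤ δ :=
    (pow_le_pow_iff_left₀ dist_nonneg hδ.le two_ne_zero).1 (by linarith)
  replace hdc : dist (unitPoint (a + s)) A ≤ δ :=
    (pow_le_pow_iff_left₀ dist_nonneg hδ.le two_ne_zero).1 (by linarith)
  have hAc : chordMap A (a + s) = a + 1 := by rw [← hAa, chordMap_chordMap hA]
  have hbc : chordMap B a < a + s := by
    by_contra! h
    have h1 := (le_chordMap_iff hB a hs).1 h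
    rw [hsideK, mul_nonneg_iff_of_pos_left hK] at h1
    have h2 := dist_sq_eq A B
    have h3 : (2 * δ) ^ 2 ≤ dist A B ^ 2 := by gcongr
    nlinarith
  have hBseg := mem_segment_chordMap hB a
  have hab : a < chordMap B a := lt_chordMap hB a
  refine ⟨a, ?_⟩
  rw [← hAc]
  refine (strictMono_chordMap hA).monotone ?_
  generalize chordMap B a = b at *
  have hle := chordMap_le_iff hC b (s := a + s - b) ⟨by linarith, by linarith [hs.2]⟩
  rw [add_sub_cancel] at hle
  rw [hle]
  have hmul := dist_mul_dist_of_mem_segment (unitPoint_sq_add_sq a) (unitPoint_sq_add_sq b) hBseg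
  have hdb : dist (unitPoint b) B ≤ δ := by
    have h1 : δ ≤ dist B (unitPoint a) := by
      have := dist_triangle A (unitPoint a) B
      rw [dist_comm A (unitPoint a), dist_comm (unitPoint a) B] at this
      linarith
    have h2 : dist (unitPoint b) B * δ ≤ δ * δ := by
      calc dist (unitPoint b) B * δ ≤ dist (unitPoint b) B * dist B (unitPoint a) := by gcongr
        _ ≤ δ * δ := by rw [hmul]; linarith
    exact le_of_mul_le_mul_right h2 hδ
  -- Replacing `b` by `B` and `a + s` by `A` costs at most `2 * δ` each, and `side B A C ≤ -4 * δ`.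
  have h1 := side_le_side_add (unitPoint b) B (unitPoint (a + s)) C
  have h2 := side_le_side_add (unitPoint (a + s)) A C B
  rw [← side_rotate B, ← side_rotate B] at h2
  have h3 : side B A C = -side A B C := by rw [side, side]; ring
  have h4 : dist (unitPoint (a + s)) C < 2 := by
    rw [dist_comm]
    exact dist_lt_two hC1 (unitPoint_sq_add_sq _).le
  have h5 : dist C B < 2 := dist_lt_two hC1 hB1.le
  have h6 : dist (unitPoint b) B * dist (unitPoint (a + s)) C ≤ δ * 2 := by gcongr
  have h7 : dist (unitPoint (a + s)) A * dist C B ≤ δ * 2 := by gcongr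
  linarith

/-- A triangle in the disk with two vertices close to the circle has rotation number `1 / 3`. -/
lemma hasRotationNumber_one_third (hT : region T ⊆ disk) {i j k : Fin 3} {δ : ℝ} (hδ : 0 < δ)
    (hside : 4 * δ ≤ |side (T.points i) (T.points j) (T.points k)|)
    (hi : 1 - δ ^ 2 ≤ T.points i 0 ^ 2 + T.points i 1 ^ 2)
    (hj : 1 - δ ^ 2 ≤ T.points j 0 ^ 2 + T.points j 1 ^ 2) :
    HasRotationNumber (billiardMap T) (1 / 3) := by
  have hd := region_subset_disk_iff.1 hT
  rw [hasRotationNumber_billiardMap_iff hT]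
  refine le_antisymm ?_ (one_third_le_translationNumber_billiardLift hT)
  have key : ∀ i j : Fin 3, 4 * δ ≤ side (T.points i) (T.points j) (T.points k) →
      1 - δ ^ 2 ≤ T.points i 0 ^ 2 + T.points i 1 ^ 2 →
      1 - δ ^ 2 ≤ T.points j 0 ^ 2 + T.points j 1 ^ 2 →
      (billiardLift hT).translationNumber ≤ 1 / 3 := by
    intro i j hs hi hj
    obtain ⟨a, ha⟩ := exists_chordMap_le (hd i) (hd j) (hd k) hδ hs hi hj
    have hmono := fun l => (strictMono_chordMap (hd l)).monotone
    exact translationNumber_le_one_third <| (billiardLift_le hT i _).trans <|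
      (hmono i ((billiardLift_le hT k _).trans (hmono k (billiardLift_le hT j a)))).trans ha
  rcases le_abs.1 hside with h | h
  · exact key i j h hi hj
  · refine key j i ?_ hj hi
    rw [side] at h ⊢
    linarith

/-- A triangle in a disk of radius `cos (5π / 12)` does not have rotation number `1 / 3`. -/
lemma not_hasRotationNumber_one_third
    (h : ∀ i, dist (T.points i) 0 ≤ cos (5 * π / 12)) :
    ¬ HasRotationNumber (billiardMap T) (1 / 3) := by
  have hc0 : 0 < cos (5 * π / 12) := cos_pos_of_mem_Ioo ⟨by linarith [pi_pos], by linarith [pi_pos]⟩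
  have hc1 : cos (5 * π / 12) < 1 := by
    rw [← cos_zero]
    exact cos_lt_cos_of_nonneg_of_le_pi le_rfl (by linarith [pi_pos]) (by linarith [pi_pos])
  have hT : region T ⊆ disk := region_subset_disk_iff.2 fun i => (h i).trans_lt hc1
  rw [hasRotationNumber_billiardMap_iff hT]
  -- A chord spanning `5 / 12` of a turn is at distance `cos (5π / 12)` from the centre. Any
  -- fraction strictly between `1 / 3` and `1 / 2` would serve.
  suffices h' : 5 / 12 ≤ (billiardLift hT).translationNumber by intro h''; linarith
  apply CircleDeg1Lift.le_translationNumber_of_add_le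
  intro x
  rw [le_billiardLift_iff]
  intro i
  have hi := region_subset_disk_iff.1 hT i
  rw [le_chordMap_iff_height hi x ⟨by norm_num, by norm_num⟩,
    show π * (5 / 12) = 5 * π / 12 by ring]
  refine le_trans ((le_abs_self _).trans (abs_le_of_sq_le_sq ?_ dist_nonneg)) (h i)
  rw [dist_sq_eq]
  have := height_sq_add (T.points i) (x + 5 / 12 / 2)
  simp only [PiLp.zero_apply, sub_zero]
  linarith [sq_nonneg (-sin (2 * π * (x + 5 / 12 / 2)) * T.points i 0 +
    cos (2 * π * (x + 5 / 12 / 2)) * T.points i 1)]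

/-! ### The smallest disk around a triangle -/

/-- The inner product of `q - p` and `x - p`. -/
def cornerInner (p q x : Plane) : ℝ := (q 0 - p 0) * (x 0 - p 0) + (q 1 - p 1) * (x 1 - p 1)

lemma angle_lt_pi_div_two_iff (q p x : Plane) :
    EuclideanGeometry.angle q p x < π / 2 ↔ 0 < cornerInner p q x := by
  have h : inner ℝ (q -ᵥ p) (x -ᵥ p) = cornerInner p q x := by
    simp [PiLp.inner_apply, Fin.sum_univ_two, cornerInner, mul_comm]
  rw [EuclideanGeometry.angle, InnerProductGeometry.angle, arccos_lt_pi_div_two, h]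
  constructor
  · intro h'
    by_contra! hc
    exact h'.not_ge (div_nonpos_of_nonpos_of_nonneg hc (by positivity))
  · intro h'
    have hne : ∀ v w : Plane, inner ℝ v w ≠ 0 → 0 < ‖v‖ * ‖w‖ := fun v w hvw => by
      have := (abs_pos.2 hvw).trans_le (abs_real_inner_le_norm v w)
      exact this
    exact div_pos h' (hne _ _ (h ▸ h'.ne'))

lemma acuteAngled_iff {T : Affine.Triangle ℝ Plane} : T.AcuteAngled ↔
    0 < cornerInner (T.points 0) (T.points 1) (T.points 2) ∧
    0 < cornerInner (T.points 1) (T.points 2) (T.points 0) ∧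
    0 < cornerInner (T.points 2) (T.points 0) (T.points 1) := by
  rw [Affine.Triangle.acuteAngled_iff_angle_lt, angle_lt_pi_div_two_iff, angle_lt_pi_div_two_iff,
    angle_lt_pi_div_two_iff]
  have h : ∀ p q x : Plane, cornerInner p q x = cornerInner p x q := fun p q x => by
    rw [cornerInner, cornerInner]; ring
  rw [h (T.points 1), h (T.points 2), h (T.points 0)]
  tauto

lemma side_points_ne_zero (T : Affine.Triangle ℝ Plane) {i j k : Fin 3} (hij : i ≠ j) (hik : i ≠ k)
    (hjk : j ≠ k) : side (T.points i) (T.points j) (T.points k) ≠ 0 := by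
  intro h
  refine affineIndependent_iff_not_collinear.1 T.independent ?_
  rw [collinear_iff_of_mem (mem_range_self i)]
  set p := T.points i
  set q := T.points j
  set x := T.points k
  have hpq : p ≠ q := (points_injective T).ne hij
  have hN : dist q p ^ 2 ≠ 0 := pow_ne_zero 2 (dist_ne_zero.2 hpq.symm)
  have hdist := dist_sq_eq q p
  rw [side] at h
  refine ⟨q - p, ?_⟩
  rintro _ ⟨l, rfl⟩
  have hl : l = i ∨ l = j ∨ l = k := by omega
  rcases hl with rfl | rfl | rfl
  · exact ⟨0, by simp [p]⟩
  · exact ⟨1, by simp [p, q]⟩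
  · refine ⟨cornerInner p q x / dist q p ^ 2, ?_⟩
    have e0 : x 0 = cornerInner p q x / dist q p ^ 2 * (q 0 - p 0) + p 0 := by
      rw [← sub_eq_iff_eq_add, div_mul_eq_mul_div, eq_div_iff hN, hdist, cornerInner]
      linear_combination (-(q 1 - p 1)) * h
    have e1 : x 1 = cornerInner p q x / dist q p ^ 2 * (q 1 - p 1) + p 1 := by
      rw [← sub_eq_iff_eq_add, div_mul_eq_mul_div, eq_div_iff hN, hdist, cornerInner]
      linear_combination (q 0 - p 0) * h
    ext n
    fin_cases n
    · simpa using e0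
    · simpa using e1

lemma side_sq_eq (p q x : Plane) : side p q x ^ 2 =
    dist p q ^ 2 * dist p x ^ 2 - ((dist p q ^ 2 + dist p x ^ 2 - dist q x ^ 2) / 2) ^ 2 := by
  rw [dist_sq_eq, dist_sq_eq, dist_sq_eq, side]
  ring

lemma dist_sq_weighted {α β γ : ℝ} (h : α + β + γ = 1) (A B C : Plane) :
    dist A (α • A + β • B + γ • C) ^ 2 = β ^ 2 * (cornerInner A B C + cornerInner B C A) +
      2 * β * γ * cornerInner A B C + γ ^ 2 * (cornerInner A B C + cornerInner C A B) := by
  obtain rfl : α = 1 - β - γ := by linarith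
  rw [dist_sq_eq]
  simp only [PiLp.add_apply, PiLp.smul_apply, smul_eq_mul, cornerInner]
  ring

/-- The circumcenter has barycentric weights proportional to `a² (b² + c² - a²)`. In terms of the
corner inner products, `q + r = |BC|²` and cyclically, and `D` is the square of twice the area;
acuteness makes the weights positive. -/
lemma exists_weights_of_acuteAngled {T : Affine.Triangle ℝ Plane} (hT : T.AcuteAngled) :
    ∃ w : Fin 3 → ℝ, (∀ i, 0 < w i) ∧ ∑ i, w i = 1 ∧
      ∀ i, dist (T.points i) (∑ l, w l • T.points l) = T.circumradius := by
  obtain ⟨hp, hq, hr⟩ := acuteAngled_iff.1 hT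
  set A := T.points 0
  set B := T.points 1
  set C := T.points 2
  set p := cornerInner A B C with hpdef
  set q := cornerInner B C A with hqdef
  set r := cornerInner C A B with hrdef
  have hD : 0 < p * q + q * r + r * p := by positivity
  set D := p * q + q * r + r * p with hDdef
  set w : Fin 3 → ℝ := ![(q + r) * p / (2 * D), (r + p) * q / (2 * D), (p + q) * r / (2 * D)]
    with hw
  have hwpos : ∀ i, 0 < w i := by
    intro i
    fin_cases i <;> simp [hw] <;> positivity
  have hwsum' : (q + r) * p / (2 * D) + (r + p) * q / (2 * D) + (p + q) * r / (2 * D) = 1 := by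
    field_simp
    rw [hDdef]
    ring
  have hwsum : ∑ i, w i = 1 := by
    rw [Fin.sum_univ_three]
    exact hwsum'
  set O := ∑ l, w l • T.points l with hO
  have hOeq : O = ((q + r) * p / (2 * D)) • A + ((r + p) * q / (2 * D)) • B +
      ((p + q) * r / (2 * D)) • C := by
    rw [hO, Fin.sum_univ_three]
    rfl
  have hsq : ∀ i, dist (T.points i) O ^ 2 = (p + q) * (q + r) * (r + p) / (4 * D) := by
    intro i
    fin_cases i
    · change dist A O ^ 2 = _
      rw [hOeq, dist_sq_weighted hwsum', ← hpdef, ← hqdef, ← hrdef]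
      field_simp
      rw [hDdef]
      ring
    · change dist B O ^ 2 = _
      rw [hOeq, show ∀ a b c : Plane, a + b + c = b + c + a from fun a b c => by abel,
        dist_sq_weighted (by linarith), ← hpdef, ← hqdef, ← hrdef]
      field_simp
      rw [hDdef]
      ring
    · change dist C O ^ 2 = _
      rw [hOeq, show ∀ a b c : Plane, a + b + c = c + a + b from fun a b c => by abel,
        dist_sq_weighted (by linarith), ← hpdef, ← hqdef, ← hrdef]
      field_simp
      rw [hDdef]
      ring
  have hdist : ∀ i, dist (T.points i) O = √((p + q) * (q + r) * (r + p) / (4 * D)) := fun i => by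
    rw [← hsq i, sqrt_sq dist_nonneg]
  have hspan : affineSpan ℝ (range T.points) = ⊤ := by
    rw [T.independent.affineSpan_eq_top_iff_card_eq_finrank_add_one]
    simp
  refine ⟨w, hwpos, hwsum, fun i => ?_⟩
  rw [← T.eq_circumradius_of_dist_eq (p := O) (by rw [hspan]; trivial) hdist]
  exact hdist i

lemma exists_cornerInner_nonpos {T : Affine.Triangle ℝ Plane} (hT : ¬ T.AcuteAngled) :
    ∃ i j k : Fin 3, i ≠ j ∧ i ≠ k ∧ j ≠ k ∧
      cornerInner (T.points k) (T.points i) (T.points j) ≤ 0 := by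
  rw [acuteAngled_iff] at hT
  by_contra! h
  exact hT ⟨h 1 2 0 (by decide) (by decide) (by decide),
    h 2 0 1 (by decide) (by decide) (by decide), h 0 1 2 (by decide) (by decide) (by decide)⟩

/-- The center `∑ l, w l • T.points l` and the radius `R` of the smallest disk that contains a
triangle; vertices of positive weight lie on its boundary. -/
lemma exists_smallest_disk (T : Affine.Triangle ℝ Plane) :
    ∃ (w : Fin 3 → ℝ) (R : ℝ), 0 < R ∧ (∀ i, 0 ≤ w i) ∧ ∑ i, w i = 1 ∧
      (∀ i, dist (T.points i) (∑ l, w l • T.points l) ≤ R) ∧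
      (∀ i, 0 < w i → dist (T.points i) (∑ l, w l • T.points l) = R) ∧
      ∃ i j k, i ≠ j ∧ i ≠ k ∧ j ≠ k ∧ 0 < w i ∧ 0 < w j := by
  by_cases hT : T.AcuteAngled
  · obtain ⟨w, hw, hsum, hdist⟩ := exists_weights_of_acuteAngled hT
    exact ⟨w, T.circumradius, T.circumradius_pos, fun i => (hw i).le, hsum, fun i => (hdist i).le,
      fun i _ => hdist i, 0, 1, 2, by decide, by decide, by decide, hw 0, hw 1⟩
  · obtain ⟨i, j, k, hij, hik, hjk, hle⟩ := exists_cornerInner_nonpos hT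
    have hall : ∀ l : Fin 3, l = i ∨ l = j ∨ l = k := by omega
    have hsum : ∀ {M : Type} [AddCommMonoid M] (f : Fin 3 → M), ∑ l, f l = f i + f j + f k := by
      intro M _ f
      have : (Finset.univ : Finset (Fin 3)) = {i, j, k} := by
        ext l
        simpa using hall l
      rw [this, Finset.sum_insert (by simp [hij, hik]), Finset.sum_insert (by simp [hjk]),
        Finset.sum_singleton, add_assoc]
    set A := T.points i
    set B := T.points j
    set C := T.points k
    have hAB : 0 < dist A B := dist_pos.2 ((points_injective T).ne hij)
    set w : Fin 3 → ℝ := fun l => if l = k then 0 else 1 / 2 with hw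
    have hwi : w i = 1 / 2 := if_neg hik
    have hwj : w j = 1 / 2 := if_neg hjk
    have hwk : w k = 0 := if_pos rfl
    have hO : ∑ l, w l • T.points l = (1 / 2 : ℝ) • A + (1 / 2 : ℝ) • B := by
      rw [hsum, hwi, hwj, hwk, zero_smul, add_zero]
    have hA : dist A ((1 / 2 : ℝ) • A + (1 / 2 : ℝ) • B) = dist A B / 2 := by
      rw [dist_eq_norm, dist_eq_norm,
        show A - ((1 / 2 : ℝ) • A + (1 / 2 : ℝ) • B) = (1 / 2 : ℝ) • (A - B) by module, norm_smul,
        norm_eq_abs, abs_of_pos (by norm_num)]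
      ring
    have hB : dist B ((1 / 2 : ℝ) • A + (1 / 2 : ℝ) • B) = dist A B / 2 := by
      rw [dist_comm A B, dist_eq_norm, dist_eq_norm,
        show B - ((1 / 2 : ℝ) • A + (1 / 2 : ℝ) • B) = (1 / 2 : ℝ) • (B - A) by module, norm_smul,
        norm_eq_abs, abs_of_pos (by norm_num)]
      ring
    -- Thales: the angle at `C` is not acute, so `C` lies in the disk with diameter `AB`.
    have hC : dist C ((1 / 2 : ℝ) • A + (1 / 2 : ℝ) • B) ≤ dist A B / 2 := by
      refine (pow_le_pow_iff_left₀ dist_nonneg (by positivity) two_ne_zero).1 ?_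
      rw [div_pow, dist_sq_eq, dist_sq_eq]
      simp only [PiLp.add_apply, PiLp.smul_apply, smul_eq_mul]
      rw [cornerInner] at hle
      linarith
    refine ⟨w, dist A B / 2, by positivity, ?_, ?_, ?_, ?_, i, j, k, hij, hik, hjk, ?_, ?_⟩
    · intro l
      rcases hall l with rfl | rfl | rfl <;> simp [*]
    · rw [hsum, hwi, hwj, hwk]
      norm_num
    · intro l
      rw [hO]
      rcases hall l with rfl | rfl | rfl
      exacts [hA.le, hB.le, hC]
    · intro l hl
      rw [hO]
      rcases hall l with rfl | rfl | rfl
      · exact hA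
      · exact hB
      · exact absurd hl (by rw [hwk]; exact lt_irrefl _)
    · rw [hwi]; norm_num
    · rw [hwj]; norm_num

/-- The parallel axis identity; the last term depends only on mutual distances, hence is a
congruence invariant. -/
lemma sum_weighted_sq (w : Fin 3 → ℝ) (hw : ∑ i, w i = 1) (x : Fin 3 → Plane) :
    ∑ i, w i * (x i 0 ^ 2 + x i 1 ^ 2) =
      dist (∑ i, w i • x i) 0 ^ 2 + (∑ i, ∑ j, w i * w j * dist (x i) (x j) ^ 2) / 2 := by
  have h : w 0 = 1 - w 1 - w 2 := by
    rw [Fin.sum_univ_three] at hw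
    linarith
  simp only [Fin.sum_univ_three, dist_sq_eq, PiLp.add_apply, PiLp.smul_apply, smul_eq_mul,
    PiLp.zero_apply, h]
  ring

/-- The triangle `T` moved by `x ↦ c • (x - O)`. -/
noncomputable def rescale (T : Affine.Triangle ℝ Plane) (O : Plane) {c : ℝ} (hc : c ≠ 0) :
    Affine.Triangle ℝ Plane where
  points i := c • (T.points i - O)
  independent := by
    refine T.independent.map' (c • (AffineMap.id ℝ Plane - AffineMap.const ℝ Plane O)) ?_
    exact (smul_right_injective Plane hc).comp sub_left_injective

@[simp] lemma rescale_points (T : Affine.Triangle ℝ Plane) (O : Plane) {c : ℝ} (hc : c ≠ 0)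
    (i : Fin 3) : (rescale T O hc).points i = c • (T.points i - O) := rfl

lemma dist_rescale (T : Affine.Triangle ℝ Plane) (O : Plane) {c : ℝ} (hc : 0 < c) (i j : Fin 3) :
    dist ((rescale T O hc.ne').points i) ((rescale T O hc.ne').points j) =
      c * dist (T.points i) (T.points j) := by
  rw [rescale_points, rescale_points, dist_smul₀, dist_sub_right, norm_eq_abs, abs_of_pos hc]

/-! ### Estimates for `kappa` -/

lemma dist_points_le (T : Affine.Triangle ℝ Plane) (i j : Fin 3) :
    dist (T.points i) (T.points j) ≤ 2 * kappa T := by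
  rw [kappa]
  split_ifs with h
  · have := dist_triangle_right (T.points i) (T.points j) T.circumcenter
    rw [T.dist_circumcenter_eq_circumradius, T.dist_circumcenter_eq_circumradius] at this
    linarith
  · have := Metric.dist_le_diam_of_mem (finite_range T.points).isBounded (mem_range_self i)
      (mem_range_self j)
    linarith

/-- In the acute case, `sum_weighted_sq` about the circumcenter identifies the mutual-distance term
with the squared circumradius; about the origin it bounds that term by a mean of squared norms below
1. -/
lemma kappa_lt_one {T : Affine.Triangle ℝ Plane} (hT : region T ⊆ disk) : kappa T < 1 := by
  have hd := fun i => mem_disk_iff.1 (region_subset_disk_iff.1 hT i)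
  rw [kappa]
  split_ifs with h
  · obtain ⟨w, hw, hsum, hdist⟩ := exists_weights_of_acuteAngled h
    have h1 := sum_weighted_sq w hsum T.points
    have h2 := sum_weighted_sq w hsum fun i => T.points i - ∑ l, w l • T.points l
    have h3 : ∑ i, w i * (T.points i 0 ^ 2 + T.points i 1 ^ 2) < ∑ i, w i :=
      Finset.sum_lt_sum_of_nonempty ⟨0, Finset.mem_univ _⟩ fun i _ => by nlinarith [hw i, hd i]
    have h4 : ∑ i, w i • (T.points i - ∑ l, w l • T.points l) = 0 := by
      simp only [smul_sub, Finset.sum_sub_distrib, ← Finset.sum_smul, hsum, one_smul, sub_self]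
    have h5 : ∀ i, (T.points i - ∑ l, w l • T.points l) 0 ^ 2 +
        (T.points i - ∑ l, w l • T.points l) 1 ^ 2 = T.circumradius ^ 2 := fun i => by
      rw [← hdist i, dist_sq_eq, PiLp.sub_apply, PiLp.sub_apply]
    simp only [h5, h4, dist_self, dist_sub_right, ← Finset.sum_mul, hsum] at h2
    have h6 := sq_nonneg (dist (∑ l, w l • T.points l) 0)
    nlinarith [T.circumradius_pos]
  · obtain ⟨⟨i, j⟩, hij⟩ := Finite.exists_max fun p : Fin 3 × Fin 3 =>
      dist (T.points p.1) (T.points p.2)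
    have hle : Metric.diam (range T.points) ≤ dist (T.points i) (T.points j) := by
      refine Metric.diam_le_of_forall_dist_le dist_nonneg ?_
      rintro _ ⟨a, rfl⟩ _ ⟨b, rfl⟩
      exact hij (a, b)
    linarith [dist_lt_two (hd i) (hd j).le]

/-- No side exceeds `2 * kappa T'`, so for smaller `kappa` moving a vertex to the origin puts a
congruent copy inside the disk of radius `cos (5π / 12)`. -/
lemma le_kappa_of_mem_admissible {T T' : Affine.Triangle ℝ Plane} (h : T' ∈ admissible T) :
    cos (5 * π / 12) / 2 ≤ kappa T' := by
  by_contra! hlt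
  have hdist : ∀ i, dist ((rescale T' (T'.points 0) one_ne_zero).points i) 0 ≤
      cos (5 * π / 12) := fun i => by
    rw [rescale_points, one_smul, dist_zero_right, ← dist_eq_norm]
    linarith [dist_points_le T' i 0]
  refine not_hasRotationNumber_one_third hdist (h.2.2 _ ?_ ?_)
  · refine region_subset_disk_iff.2 fun i => (hdist i).trans_lt ?_
    rw [← cos_zero]
    exact cos_lt_cos_of_nonneg_of_le_pi le_rfl (by linarith [pi_pos]) (by linarith [pi_pos])
  · rw [congruent_iff_dist_eq]
    intro i j
    rw [dist_rescale T' (T'.points 0) one_pos, one_mul]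

/-- A copy of the triangle whose smallest enclosing disk is almost the unit disk is admissible. -/
lemma admissible_nonempty (T : Affine.Triangle ℝ Plane) : (admissible T).Nonempty := by
  obtain ⟨w, R, hR, hw, hsum, hle, heq, i, j, k, hij, hik, hjk, hi, hj⟩ := exists_smallest_disk T
  set O := ∑ l, w l • T.points l with hO
  set S := |side (T.points i) (T.points j) (T.points k)| with hS
  have hS0 : 0 < S := abs_pos.2 (side_points_ne_zero T hij hik hjk)
  -- Since `η ≤ 1 / 2`, the rescaled determinant is at least `S / (2 * R ^ 2) = 4 * δ`.
  set δ := S / (8 * R ^ 2) with hδ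
  have hδ0 : 0 < δ := by positivity
  obtain ⟨η, hη0, hη1, hηi, hηj⟩ : ∃ η : ℝ, 0 < η ∧ η ≤ 1 / 2 ∧ η ≤ w i * δ ^ 2 ∧
      η ≤ w j * δ ^ 2 :=
    ⟨min (1 / 2) (min (w i * δ ^ 2) (w j * δ ^ 2)), by positivity, min_le_left _ _,
      (min_le_right _ _).trans (min_le_left _ _), (min_le_right _ _).trans (min_le_right _ _)⟩
  obtain ⟨t, ht0, ht⟩ : ∃ t : ℝ, 0 < t ∧ t ^ 2 = 1 - η :=
    ⟨√(1 - η), sqrt_pos.2 (by linarith), sq_sqrt (by linarith)⟩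
  have ht1 : t < 1 := by nlinarith
  have hc : 0 < t / R := by positivity
  refine ⟨rescale T O hc.ne', ?_, ?_, ?_⟩
  · refine region_subset_disk_iff.2 fun l => ?_
    rw [disk, mem_ball_zero_iff, rescale_points, norm_smul, norm_eq_abs, abs_of_pos hc,
      ← dist_eq_norm]
    calc t / R * dist (T.points l) O ≤ t / R * R := by gcongr; exact hle l
      _ = t := by field_simp
      _ < 1 := ht1
  · rw [similar_iff_exists_dist_eq]
    exact ⟨⟨t / R, hc.le⟩, fun h => hc.ne' (congrArg NNReal.toReal h), dist_rescale T O hc⟩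
  · intro T' hT' hcong
    rw [congruent_iff_dist_eq] at hcong
    have hd : ∀ a b, dist (T'.points a) (T'.points b) = t / R * dist (T.points a) (T.points b) :=
      fun a b => (hcong a b).trans (dist_rescale T O hc a b)
    have hmoment : (∑ a, ∑ b, w a * w b * dist (T.points a) (T.points b) ^ 2) / 2 = R ^ 2 := by
      have h2 := sum_weighted_sq w hsum fun l => T.points l - O
      have h4 : ∑ l, w l • (T.points l - O) = 0 := by
        simp only [smul_sub, Finset.sum_sub_distrib, ← Finset.sum_smul, hsum, one_smul, ← hO,
          sub_self]
      have h5 : ∀ l, w l * ((T.points l - O) 0 ^ 2 + (T.points l - O) 1 ^ 2) = w l * R ^ 2 := by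
        intro l
        rcases (hw l).eq_or_lt with h | h
        · rw [← h, zero_mul, zero_mul]
        · rw [← heq l h, dist_sq_eq, PiLp.sub_apply, PiLp.sub_apply]
      simp only [h5, h4, dist_self, dist_sub_right, ← Finset.sum_mul, hsum] at h2
      linarith
    have hnear : 1 - η ≤ ∑ l, w l * (T'.points l 0 ^ 2 + T'.points l 1 ^ 2) := by
      have h1 := sum_weighted_sq w hsum T'.points
      have h2 : ∑ a, ∑ b, w a * w b * dist (T'.points a) (T'.points b) ^ 2 =
          (t / R) ^ 2 * ∑ a, ∑ b, w a * w b * dist (T.points a) (T.points b) ^ 2 := by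
        simp only [Finset.mul_sum, hd]
        refine Finset.sum_congr rfl fun a _ => Finset.sum_congr rfl fun b _ => ?_
        ring
      rw [h1, h2, mul_div_assoc, hmoment, ← ht, div_pow, div_mul_cancel₀ _ (by positivity)]
      linarith [sq_nonneg (dist (∑ l, w l • T'.points l) 0)]
    -- The deficits `1 - |x|²` are nonnegative with weighted sum at most `η`, so each weighted
    -- deficit is at most `η`.
    have hvertex : ∀ l, 0 < w l → η ≤ w l * δ ^ 2 →
        1 - δ ^ 2 ≤ T'.points l 0 ^ 2 + T'.points l 1 ^ 2 := by
      intro l hl hηl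
      have h1 : w l * (1 - (T'.points l 0 ^ 2 + T'.points l 1 ^ 2)) ≤
          ∑ a, w a * (1 - (T'.points a 0 ^ 2 + T'.points a 1 ^ 2)) :=
        Finset.single_le_sum (f := fun a => w a * (1 - (T'.points a 0 ^ 2 + T'.points a 1 ^ 2)))
          (fun a _ => mul_nonneg (hw a)
            (by linarith [mem_disk_iff.1 (region_subset_disk_iff.1 hT' a)])) (Finset.mem_univ l)
      simp only [mul_one_sub, Finset.sum_sub_distrib, hsum] at h1
      have h2 : w l * (1 - (T'.points l 0 ^ 2 + T'.points l 1 ^ 2)) ≤ w l * δ ^ 2 := by linarith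
      linarith [le_of_mul_le_mul_left h2 hl]
    refine hasRotationNumber_one_third hT' (i := i) (j := j) (k := k) hδ0 ?_ (hvertex i hi hηi)
      (hvertex j hj hηj)
    -- A congruence may reverse orientation; side lengths determine the determinant only up to sign.
    have hside : |side (T'.points i) (T'.points j) (T'.points k)| = (t / R) ^ 2 * S := by
      rw [hS, ← sq_eq_sq₀ (abs_nonneg _) (by positivity), mul_pow, sq_abs, sq_abs, side_sq_eq,
        side_sq_eq, hd, hd, hd]
      ring
    rw [hside, hδ, div_pow, ht]
    calc 4 * (S / (8 * R ^ 2)) = (1 / 2) / R ^ 2 * S := by field_simp; norm_num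
      _ ≤ (1 - η) / R ^ 2 * S := by gcongr; linarith

end BarBilliard

theorem proposition5p2 (T : Affine.Triangle ℝ BarBilliard.Plane) :
    (BarBilliard.admissible T).Nonempty ∧ 0 < BarBilliard.mu T ∧ BarBilliard.mu T < 1 := by
  have hne := BarBilliard.admissible_nonempty T
  have hlower : ∀ r ∈ BarBilliard.kappa '' BarBilliard.admissible T,
      Real.cos (5 * Real.pi / 12) / 2 ≤ r := by
    rintro _ ⟨T', hT', rfl⟩
    exact BarBilliard.le_kappa_of_mem_admissible hT'
  refine ⟨hne, ?_, ?_⟩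
  · refine lt_of_lt_of_le (half_pos ?_) (le_csInf (hne.image _) hlower)
    exact Real.cos_pos_of_mem_Ioo ⟨by linarith [Real.pi_pos], by linarith [Real.pi_pos]⟩
  · obtain ⟨T', hT'⟩ := hne
    exact (csInf_le ⟨_, hlower⟩ (Set.mem_image_of_mem _ hT')).trans_lt
      (BarBilliard.kappa_lt_one hT'.1)
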